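/- Let $\zeta$ be the Riemann zeta-function and write $s = \sigma + it$ with $\sigma, t$ real. The Riemann hypothesis holds if and only if $$|\zeta(1-s)| > |\zeta(s)| \quad\text{for all } s=\sigma+it \text{ with } \sigma > \tfrac12 \text{ and } |t| \ge 6.29073.$$ -/

import Mathlib

open Complex MeasureTheory Set Filter Topology

/-! By the functional equation, `ζ(1-s) = χ ζ(s)` with `χ = 2 (2π)^(-s) Γ(s) cos(πs/2)`. On the
critical line `|χ| = 1`, and for `|t| ≥ 6.29073` (just above `2π`) `log |χ|` increases strictly with
`σ`: its derivative is `Re ψ(s) - log 2π` up to a tiny trigonometric term, and Stirling gives `Re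
ψ(s) > log 2π`. Hence `|χ| > 1` for `σ > 1/2` (`one_lt_norm_Gamma_factor`), and under RH `ζ(s) ≠ 0`
gives the inequality. Conversely, a zero with `1/2 < σ < 1` and `|t| ≥ 6.29073` would turn the
inequality into `0 < 0`. Lower zeros are excluded outright (`riemannZeta_ne_zero_of_abs_im_lt`): a
zero forces `Λ₀(s) s (1-s) = 1`, but `|Λ₀| ≤ Λ₀(1) < 0.024645` on the critical strip. -/

/-! ### Absence of zeros of small height. -/

lemma norm_mellin_le_integral (F : ℝ → ℂ) (s : ℂ) :
    ‖mellin F s‖ ≤ ∫ x in Ioi (0 : ℝ), x ^ (s.re - 1) * ‖F x‖ := by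
  refine (norm_integral_le_integral_norm _).trans (le_of_eq ?_)
  refine setIntegral_congr_fun measurableSet_Ioi fun x hx ↦ ?_
  simp [norm_cpow_eq_rpow_re_of_pos (mem_Ioi.mp hx)]

lemma MellinConvergent.integrableOn_rpow_mul_norm {F : ℝ → ℂ} {s : ℂ}
    (h : MellinConvergent F s) :
    IntegrableOn (fun x ↦ x ^ (s.re - 1) * ‖F x‖) (Ioi (0 : ℝ)) := by
  refine IntegrableOn.congr_fun h.norm (fun x hx ↦ ?_) measurableSet_Ioi
  simp [norm_cpow_eq_rpow_re_of_pos (mem_Ioi.mp hx)]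

lemma mellin_ofReal_eq_integral {F : ℝ → ℂ} (hF : ∀ x, 0 < x → (‖F x‖ : ℂ) = F x) (σ : ℝ) :
    mellin F σ = ((∫ x in Ioi (0 : ℝ), x ^ (σ - 1) * ‖F x‖ : ℝ) : ℂ) := by
  rw [← integral_complex_ofReal]
  refine setIntegral_congr_fun measurableSet_Ioi fun x hx ↦ ?_
  have hx' : 0 < x := hx
  simp [ofReal_cpow hx'.le, hF x hx']

/-- The Mellin transform of a nonnegative function is bounded on a vertical strip by the
interpolation of its values at the two real boundary points. -/
lemma norm_mellin_le_of_nonneg {F : ℝ → ℂ} (hF : ∀ x, 0 < x → (‖F x‖ : ℂ) = F x)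
    (hc : ∀ s, MellinConvergent F s) {a b θ : ℝ} (h0 : 0 ≤ θ) (h1 : θ ≤ 1) {s : ℂ}
    (hs : s.re = (1 - θ) * a + θ * b) :
    ‖mellin F s‖ ≤ (1 - θ) * ‖mellin F a‖ + θ * ‖mellin F b‖ := by
  have hint (σ : ℝ) := (hc (σ : ℂ)).integrableOn_rpow_mul_norm
  simp only [ofReal_re] at hint
  have key (σ : ℝ) : ‖mellin F σ‖ = ∫ x in Ioi (0 : ℝ), x ^ (σ - 1) * ‖F x‖ := by
    rw [mellin_ofReal_eq_integral hF, norm_real, Real.norm_of_nonneg]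
    refine setIntegral_nonneg measurableSet_Ioi fun x hx ↦ ?_
    have hx' : 0 < x := hx
    positivity
  rw [key, key, ← integral_const_mul, ← integral_const_mul,
    ← integral_add ((hint a).const_mul _) ((hint b).const_mul _)]
  refine (norm_mellin_le_integral F s).trans ?_
  refine setIntegral_mono_on (hint s.re) (((hint a).const_mul _).add ((hint b).const_mul _))
    measurableSet_Ioi fun x hx ↦ ?_
  have hx' : 0 < x := hx
  -- Weighted AM-GM: the power at the intermediate abscissa lies below the convex combination of the
  -- endpoint powers.
  have := Real.geom_mean_le_arith_mean2_weighted (sub_nonneg.mpr h1) h0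
    (Real.rpow_nonneg hx'.le (a - 1)) (Real.rpow_nonneg hx'.le (b - 1)) (by ring)
  rw [← Real.rpow_mul hx'.le, ← Real.rpow_mul hx'.le, ← Real.rpow_add hx',
    show (a - 1) * (1 - θ) + (b - 1) * θ = s.re - 1 by rw [hs]; ring] at this
  calc x ^ (s.re - 1) * ‖F x‖ ≤ ((1 - θ) * x ^ (a - 1) + θ * x ^ (b - 1)) * ‖F x‖ := by gcongr
    _ = _ := by ring

namespace HurwitzZeta

lemma one_le_evenKernel_zero {x : ℝ} (hx : 0 < x) : 1 ≤ evenKernel 0 x := by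
  have h := hasSum_int_evenKernel₀ 0 hx
  have := h.nonneg fun n ↦ by split_ifs <;> positivity
  simpa using this

/-- With `θ` the even kernel, `f_modif` is `θ(x) - 1` for `x > 1` and `θ(x) - x^(-1/2) = x^(-1/2)
(θ(1/x) - 1)` for `x < 1`; both are nonnegative because `θ ≥ 1`. -/
lemma ofReal_norm_f_modif {x : ℝ} (hx : 0 < x) :
    (‖(hurwitzEvenFEPair 0).f_modif x‖ : ℂ) = (hurwitzEvenFEPair 0).f_modif x := by
  suffices ∃ r : ℝ, 0 ≤ r ∧ (hurwitzEvenFEPair 0).f_modif x = r by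
    obtain ⟨r, hr, h⟩ := this
    rw [h, norm_real, Real.norm_of_nonneg hr]
  rcases lt_trichotomy x 1 with h | rfl | h
  · refine ⟨evenKernel 0 x - x ^ (-(1 / 2) : ℝ), ?_, ?_⟩
    · rw [evenKernel_functional_equation, ← evenKernel_eq_cosKernel_of_zero, Real.rpow_neg hx.le,
        ← one_div, sub_nonneg]
      exact le_mul_of_one_le_right (by positivity) (one_le_evenKernel_zero (by positivity))
    · simp [WeakFEPair.f_modif, hx, h, h.le, hurwitzEvenFEPair]
  · exact ⟨0, le_rfl, by simp [WeakFEPair.f_modif]⟩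
  · refine ⟨evenKernel 0 x - 1, sub_nonneg.mpr (one_le_evenKernel_zero hx), ?_⟩
    simp [WeakFEPair.f_modif, h, h.le, hurwitzEvenFEPair]

end HurwitzZeta

open HurwitzZeta in
-- The symmetry `Λ₀(0) = Λ₀(1)` makes the interpolated bound constant across the strip.
lemma norm_completedRiemannZeta₀_le {s : ℂ} (h0 : 0 ≤ s.re) (h1 : s.re ≤ 1) :
    ‖completedRiemannZeta₀ s‖ ≤ ‖completedRiemannZeta₀ 1‖ := by
  have h01 : completedRiemannZeta₀ 0 = completedRiemannZeta₀ 1 := by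
    simpa using completedRiemannZeta₀_one_sub 1
  have hΛ (z : ℂ) : completedRiemannZeta₀ z = mellin (hurwitzEvenFEPair 0).f_modif (z / 2) / 2 :=
    rfl
  have hc (z : ℂ) : MellinConvergent (hurwitzEvenFEPair 0).f_modif z :=
    ((hurwitzEvenFEPair 0).isStrongFEPair_toStrongFEPair.hasMellin z).1
  have := norm_mellin_le_of_nonneg (fun x hx ↦ ofReal_norm_f_modif hx) hc (a := 0) (b := 1 / 2)
    h0 h1 (s := s / 2) (by simp; ring)
  have e0 := hΛ 0
  have e1 := hΛ 1
  rw [h01] at e0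
  rw [hΛ s, norm_div]
  have n0 := congrArg norm e0
  have n1 := congrArg norm e1
  rw [norm_div] at n0 n1
  simp only [zero_div, ofReal_zero, ofReal_div, ofReal_one, ofReal_ofNat, norm_ofNat] at *
  nlinarith

lemma norm_completedRiemannZeta₀_one_lt : ‖completedRiemannZeta₀ 1‖ < 0.024645 := by
  -- `Λ₀(1) = (γ - log 4π)/2 + 1`. The index 256 is a power of 2, so `γ < H₂₅₆ - log 256` involves
  -- only `log 2`.
  have hγ := Real.eulerMascheroniConstant_lt_eulerMascheroniSeq' 256
  have hH : harmonic 256 ≤ 122487 / 20000 := by decide +kernel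
  have hH' : ((harmonic 256 : ℚ) : ℝ) ≤ ((122487 / 20000 : ℚ) : ℝ) := by exact_mod_cast hH
  push_cast at hH'
  have h256 : Real.log (256 : ℕ) = 8 * Real.log 2 := by
    rw [show ((256 : ℕ) : ℝ) = 2 ^ 8 by norm_num, Real.log_pow]; norm_num
  rw [Real.eulerMascheroniSeq', if_neg (by norm_num), h256] at hγ
  have hπ : 33 * Real.log 2 ≤ 20 * Real.log Real.pi := by
    have : Real.log ((2 : ℝ) ^ 33) ≤ Real.log (Real.pi ^ 20) := by
      refine Real.log_le_log (by norm_num) ?_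
      calc (2 : ℝ) ^ 33 ≤ 3.14 ^ 20 := by norm_num
        _ ≤ Real.pi ^ 20 := by gcongr; exact Real.pi_gt_d2.le
    simpa [Real.log_pow] using this
  have h4 : Real.log (4 * Real.pi) = 2 * Real.log 2 + Real.log Real.pi := by
    rw [Real.log_mul (by norm_num) Real.pi_ne_zero, show (4 : ℝ) = 2 ^ 2 by norm_num, Real.log_pow]
    norm_num
  have hl := Real.log_two_gt_d9
  have hγ2 := Real.one_half_lt_eulerMascheroniConstant
  have heq : completedRiemannZeta₀ 1 =
      (((Real.eulerMascheroniConstant - Real.log (4 * Real.pi)) / 2 + 1 : ℝ) : ℂ) := by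
    rw [completedRiemannZeta₀_one, ofReal_add, ofReal_div, ofReal_sub,
      ofReal_log (by positivity)]
    push_cast
    rfl
  have hp : Real.log Real.pi ≤ 1.1 + 0.05 := by
    rw [Real.log_le_iff_le_exp Real.pi_pos]
    refine Real.pi_lt_d2.le.trans ?_
    refine le_trans ?_ (Real.sum_le_exp_of_nonneg (by norm_num) 8)
    norm_num [Finset.sum_range_succ, Nat.factorial]
  rw [heq, norm_real, Real.norm_eq_abs, abs_lt, h4]
  have hl2 := Real.log_two_lt_d9
  constructor <;> linarith

/-- The Riemann zeta function has no zero of small height in the closed right half of the critical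
strip. -/
lemma riemannZeta_ne_zero_of_abs_im_lt {s : ℂ} (h0 : 0 < s.re) (h1 : s.re ≤ 1)
    (him : |s.im| < 6.29073) : riemannZeta s ≠ 0 := by
  intro hζ
  rcases eq_or_ne s 1 with rfl | hs1
  · exact riemannZeta_one_ne_zero hζ
  have hs0 : s ≠ 0 := by rintro rfl; simp at h0
  rw [riemannZeta_def_of_ne_zero hs0, div_eq_zero_iff,
    or_iff_left (Gammaℝ_ne_zero_of_re_pos h0), completedRiemannZeta_eq] at hζ
  have hs1' : 1 - s ≠ 0 := sub_ne_zero.mpr hs1.symm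
  have hprod : completedRiemannZeta₀ s * (s * (1 - s)) = 1 := by
    have : completedRiemannZeta₀ s = 1 / s + 1 / (1 - s) := by linear_combination hζ
    rw [this]; field_simp; ring
  have hn := congrArg norm hprod
  rw [norm_mul, norm_mul, norm_one] at hn
  have him2 : s.im ^ 2 < 39.5733 := by
    rw [← sq_abs]; nlinarith [abs_nonneg s.im]
  have ha : ‖s‖ ^ 2 ≤ 40.5733 := by
    rw [← normSq_eq_norm_sq, normSq_apply]; nlinarith
  have hb : ‖1 - s‖ ^ 2 ≤ 40.5733 := by
    rw [← normSq_eq_norm_sq, normSq_apply]; simp; nlinarith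
  have hab : ‖s‖ * ‖1 - s‖ ≤ 40.5733 := by nlinarith [sq_nonneg (‖s‖ - ‖1 - s‖)]
  have hΛ := (norm_completedRiemannZeta₀_le h0.le h1).trans norm_completedRiemannZeta₀_one_lt.le
  -- `40.5733` is `1 + 6.29073²` rounded up; the product on the right is just below 1.
  have : ‖completedRiemannZeta₀ s‖ * (‖s‖ * ‖1 - s‖) ≤ 0.024645 * 40.5733 :=
    mul_le_mul hΛ hab (by positivity) (by norm_num)
  rw [hn] at this
  norm_num at this
-- A Stirling-type bound by telescoping.
lemma two_mul_add_cube_le_log {u : ℝ} (h0 : 0 ≤ u) (h1 : u < 1) :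
    2 * (u + u ^ 3 / 3) ≤ Real.log (1 + u) - Real.log (1 - u) := by
  have h := Real.hasSum_log_sub_log_of_abs_lt_one (abs_lt.mpr ⟨by linarith, h1⟩)
  have := sum_le_hasSum (Finset.range 2) (fun k _ ↦ by positivity) h
  simp only [Finset.sum_range_succ, Finset.sum_range_zero] at this
  norm_num at this
  linarith

/-- A minorant of `log |x + i t|` corrected to second order in the Stirling expansion, whose unit
differences dominate `Re (x + i t)⁻¹`. -/
noncomputable def stirlingMinorant (t x : ℝ) : ℝ :=
  Real.log (x ^ 2 + t ^ 2) / 2 - t ^ 2 / (12 * (x ^ 2 + t ^ 2) ^ 2)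
    + (1 / 24 - 0.0035) / (x ^ 2 + t ^ 2)

/-- Since `ψ(w + 1/2) = log w + 1/(24 w²) + ⋯`, the minorant is `log |w| + Re (1/(24 w²)) -
0.0035/|w|²` at `w = x + it`. In the numerator below, `1/24` cancels the leading `M³` term exactly;
the slack `0.0035` restores `0.007 M³`, which beats the lower terms once `M ≥ 39.5`. -/
lemma stirling_error_nonneg {M : ℝ} (hM : 39.5 ≤ M) :
    0 ≤ 1 / M - 1 / (M - 1 / 4) + (M - 1 / 4) / (3 * M ^ 3)
      - 2 * (1 / 24 - 0.0035) / (M ^ 2 - M) := by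
  have h1 : 0 < M - 1 / 4 := by linarith
  have h2 : 0 < M - 1 := by linarith
  have hM0 : 0 < M := by linarith
  have : 1 / M - 1 / (M - 1 / 4) + (M - 1 / 4) / (3 * M ^ 3)
      - 2 * (1 / 24 - 0.0035) / (M ^ 2 - M) =
      (-(1 / 4) * M ^ 2 * (M - 1) + (M - 1 / 4) ^ 2 * (M - 1) / 3
        - 2 * (1 / 24 - 0.0035) * M ^ 2 * (M - 1 / 4)) / (M ^ 3 * (M - 1 / 4) * (M - 1)) := by
    obtain ⟨k, hk⟩ : ∃ k, k = M - 1 / 4 := ⟨_, rfl⟩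
    rw [show M ^ 2 - M = M * (M - 1) by ring, ← hk]
    rw [← hk] at h1
    field_simp
    rw [hk]
    ring
  rw [this]
  refine div_nonneg ?_ (by positivity)
  obtain ⟨m, rfl⟩ : ∃ m, M = m + 39.5 := ⟨M - 39.5, by ring⟩
  have hm : 0 ≤ m := by linarith
  ring_nf
  positivity

lemma div_le_stirlingMinorant_sub {t x : ℝ} (ht : 39.5 ≤ t ^ 2) (hx : 0 < x) :
    x / (x ^ 2 + t ^ 2) ≤ stirlingMinorant t (x + 1 / 2) - stirlingMinorant t (x - 1 / 2) := by
  have ht0 : 0 < t ^ 2 := by linarith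
  set v := t ^ 2 with hv
  set M := x ^ 2 + v + 1 / 4 with hM
  have hM39 : 39.5 ≤ M := by nlinarith
  have hM0 : 0 < M := by linarith
  have hxM : x < M := by nlinarith [sq_nonneg (x - 1 / 2)]
  have hx2 : x ^ 2 ≤ M := by linarith
  have hQ1 : M ^ 2 - M ≤ M ^ 2 - x ^ 2 := by linarith
  have hMM : 0 < M ^ 2 - M := by nlinarith
  have hQ0 : 0 < M ^ 2 - x ^ 2 := hMM.trans_le hQ1
  -- Centring at `M` makes the two squared moduli `M ± x`, so the logarithms differ by an odd series
  -- in `x / M`.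
  have hp : (x + 1 / 2) ^ 2 + v = M * (1 + x / M) := by field_simp; rw [hM]; ring
  have hm : (x - 1 / 2) ^ 2 + v = M * (1 - x / M) := by field_simp; rw [hM]; ring
  have hu1 : x / M < 1 := (div_lt_one hM0).mpr hxM
  have hu0 : 0 < x / M := by positivity
  have hlog := two_mul_add_cube_le_log hu0.le hu1
  have hone : (0 : ℝ) < 1 - x / M := by linarith
  have herr := stirling_error_nonneg hM39
  unfold stirlingMinorant
  rw [← hv, hp, hm, Real.log_mul hM0.ne' (by positivity), Real.log_mul hM0.ne' hone.ne']
  have e1 : M * (1 + x / M) = M + x := by field_simp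
  have e2 : M * (1 - x / M) = M - x := by field_simp
  rw [e1, e2]
  have hMx : 0 < M - x := by linarith
  have hMx' : 0 < M + x := by linarith
  have hrat : v / (12 * (M - x) ^ 2) - v / (12 * (M + x) ^ 2)
      + (1 / 24 - 0.0035) / (M + x) - (1 / 24 - 0.0035) / (M - x) =
      x * (v * M / (3 * (M ^ 2 - x ^ 2) ^ 2) - 2 * (1 / 24 - 0.0035) / (M ^ 2 - x ^ 2)) := by
    rw [show M ^ 2 - x ^ 2 = (M - x) * (M + x) by ring]
    field_simp
    ring
  have hD : x ^ 2 + v = M - 1 / 4 := by rw [hM]; ring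
  have b1 : v / (3 * M ^ 3) ≤ v * M / (3 * (M ^ 2 - x ^ 2) ^ 2) := by
    rw [show v / (3 * M ^ 3) = v * M / (3 * (M ^ 2) ^ 2) by field_simp]
    gcongr
    nlinarith
  have b2 : 2 * (1 / 24 - 0.0035) / (M ^ 2 - x ^ 2) ≤ 2 * (1 / 24 - 0.0035) / (M ^ 2 - M) := by
    gcongr
  have hmain : 0 ≤ x * (1 / M - 1 / (M - 1 / 4) + x ^ 2 / (3 * M ^ 3)
      + (v * M / (3 * (M ^ 2 - x ^ 2) ^ 2) - 2 * (1 / 24 - 0.0035) / (M ^ 2 - x ^ 2))) := by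
    refine mul_nonneg hx.le ?_
    have : (M - 1 / 4) / (3 * M ^ 3) = x ^ 2 / (3 * M ^ 3) + v / (3 * M ^ 3) := by
      rw [← hD]; ring
    linarith
  have e3 : x * (1 / M - 1 / (M - 1 / 4) + x ^ 2 / (3 * M ^ 3)) =
      x / M - x / (M - 1 / 4) + (x / M) ^ 3 / 3 := by
    field_simp
  rw [mul_add, e3] at hmain
  rw [hD]
  linarith

/-- The threshold matters here: `log (6.29073/2π) ≥ 0.001199` outweighs the correction terms, which
cost at most `0.001142`. -/
lemma log_two_pi_le_stirlingMinorant {t : ℝ} (ht : 6.29073 ≤ |t|) (x : ℝ) :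
    Real.log (2 * Real.pi) + 1e-5 ≤ stirlingMinorant t x := by
  have ht2 : (6.29073 : ℝ) ^ 2 ≤ t ^ 2 := by rw [← sq_abs t]; gcongr
  set v := t ^ 2 with hv
  set D := x ^ 2 + v with hD
  have hv0 : 0 < v := lt_of_lt_of_le (by norm_num) ht2
  have hvD : v ≤ D := by nlinarith
  have hTD : (6.29073 : ℝ) ^ 2 ≤ D := ht2.trans hvD
  have hD0 : 0 < D := hv0.trans_le hvD
  unfold stirlingMinorant
  rw [← hv, ← hD]
  have h1 : 2 * Real.log 6.29073 ≤ Real.log D := by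
    rw [← Nat.cast_ofNat (R := ℝ), ← Real.log_pow]
    exact Real.log_le_log (by norm_num) hTD
  have h2 : v / (12 * D ^ 2) ≤ 1 / 12 / D := by
    rw [div_div, div_le_div_iff₀ (by positivity) (by positivity)]
    nlinarith [mul_pos hD0 hD0]
  have h3 : 1 / 12 / D - (1 / 24 - 0.0035) / D ≤ 0.001142 := by
    rw [← sub_div, div_le_iff₀ hD0]
    norm_num at hTD ⊢
    linarith
  have hπ := Real.pi_lt_d6
  have hπ0 := Real.pi_pos
  have h4 : 0.001199 ≤ Real.log 6.29073 - Real.log (2 * Real.pi) := by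
    rw [← Real.log_div (by norm_num) (by positivity)]
    refine le_trans ?_ (Real.one_sub_inv_le_log_of_pos (by positivity))
    rw [inv_div, le_sub_comm, div_le_iff₀ (by norm_num)]
    linarith
  norm_num at *
  linarith

lemma stirlingMinorant_le {t x : ℝ} (hx : 1 ≤ x) :
    stirlingMinorant t x ≤ Real.log (x + |t|) + 1 / x := by
  have hx0 : 0 < x := by linarith
  have h1 : Real.log (x ^ 2 + t ^ 2) / 2 ≤ Real.log (x + |t|) := by
    have : Real.log (x ^ 2 + t ^ 2) ≤ Real.log ((x + |t|) ^ 2) := by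
      refine Real.log_le_log (by positivity) ?_
      nlinarith [sq_abs t, mul_nonneg hx0.le (abs_nonneg t)]
    rw [Real.log_pow] at this
    push_cast at this
    linarith
  have h2 : 0 ≤ t ^ 2 / (12 * (x ^ 2 + t ^ 2) ^ 2) := by positivity
  have h3 : (1 / 24 - 0.0035) / (x ^ 2 + t ^ 2) ≤ 1 / x := by
    rw [div_le_div_iff₀ (by positivity) hx0]
    nlinarith [sq_nonneg t]
  unfold stirlingMinorant
  linarith

lemma sum_div_le_stirlingMinorant_sub {t y : ℝ} (ht : 39.5 ≤ t ^ 2) (hy : 0 < y) (n : ℕ) :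
    ∑ j ∈ Finset.range n, (y + j) / ((y + j) ^ 2 + t ^ 2) ≤
      stirlingMinorant t (y + n - 1 / 2) - stirlingMinorant t (y - 1 / 2) := by
  induction n with
  | zero => simp
  | succ n ih =>
    rw [Finset.sum_range_succ]
    have := div_le_stirlingMinorant_sub ht (show 0 < y + n by positivity)
    rw [show y + (n + 1 : ℕ) - 1 / 2 = y + n + 1 / 2 by push_cast; ring]
    linarith

/-! ### Growth of the functional-equation factor. -/

/-- The logarithm, up to an additive constant independent of `y`, of the `n`-th Gauss approximation
to `|2 (2π)⁻ˢ Γ(s) cos (π s / 2)|` at `s = y + i t`. -/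
noncomputable def logFactorSeq (t : ℝ) (n : ℕ) (y : ℝ) : ℝ :=
  y * Real.log n - y * Real.log (2 * Real.pi)
    - (∑ j ∈ Finset.range (n + 1), Real.log ((y + j) ^ 2 + t ^ 2)) / 2
    + Real.log (Real.cosh (Real.pi * t) + Real.cos (Real.pi * y)) / 2

lemma lt_cosh_pi_mul {t : ℝ} (ht : 6.29073 ≤ |t|) : 400000 < Real.cosh (Real.pi * t) := by
  have h18 : (18 : ℝ) ≤ |Real.pi * t| := by
    rw [abs_mul, abs_of_pos Real.pi_pos]
    nlinarith [Real.pi_gt_three]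
  rw [← Real.cosh_abs]
  have h1 : Real.exp 18 ≤ Real.exp |Real.pi * t| := Real.exp_le_exp.mpr h18
  have h2 : (2.7 : ℝ) ^ 18 ≤ Real.exp 18 := by
    rw [show (18 : ℝ) = (18 : ℕ) * 1 by norm_num, Real.exp_nat_mul]
    gcongr
    exact (lt_trans (by norm_num) Real.exp_one_gt_d9).le
  rw [Real.cosh_eq]
  have := Real.exp_pos (-|Real.pi * t|)
  norm_num at h2
  linarith

lemma hasDerivAt_logFactorSeq {t : ℝ} (ht : 6.29073 ≤ |t|) (n : ℕ) (y : ℝ) :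
    HasDerivAt (logFactorSeq t n)
      (Real.log n - Real.log (2 * Real.pi)
        - ∑ j ∈ Finset.range (n + 1), (y + j) / ((y + j) ^ 2 + t ^ 2)
        - Real.pi * Real.sin (Real.pi * y) /
            (2 * (Real.cosh (Real.pi * t) + Real.cos (Real.pi * y)))) y := by
  have ht0 : t ≠ 0 := by rintro rfl; norm_num at ht
  have hc : 0 < Real.cosh (Real.pi * t) + Real.cos (Real.pi * y) := by
    linarith [lt_cosh_pi_mul ht, Real.neg_one_le_cos (Real.pi * y)]
  have hsum : HasDerivAt
      (fun y : ℝ ↦ ∑ j ∈ Finset.range (n + 1), Real.log ((y + j) ^ 2 + t ^ 2))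
      (∑ j ∈ Finset.range (n + 1), 2 * (y + j) / ((y + j) ^ 2 + t ^ 2)) y := by
    refine HasDerivAt.fun_sum fun j _ ↦ ?_
    have := ((((hasDerivAt_id y).add_const (j : ℝ)).pow 2).add_const (t ^ 2)).log
      (show (y + j) ^ 2 + t ^ 2 ≠ 0 by positivity)
    simpa using this
  have hcos : HasDerivAt
      (fun y : ℝ ↦ Real.log (Real.cosh (Real.pi * t) + Real.cos (Real.pi * y)))
      (-(Real.sin (Real.pi * y) * Real.pi) /
        (Real.cosh (Real.pi * t) + Real.cos (Real.pi * y))) y := by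
    have := ((((hasDerivAt_id y).const_mul Real.pi).cos).const_add
      (Real.cosh (Real.pi * t))).log hc.ne'
    simpa using this
  have := ((((hasDerivAt_id y).mul_const (Real.log n)).sub
    ((hasDerivAt_id y).mul_const (Real.log (2 * Real.pi)))).sub (hsum.div_const 2)).add
    (hcos.div_const 2)
  refine HasDerivAt.congr_deriv (f := logFactorSeq t n) this ?_
  simp only [mul_div_assoc, ← Finset.mul_sum]
  field_simp
  ring

/-- The Stirling margin `1e-5` loses at most `5e-6` to the trigonometric term, as `cosh(πt) >
400000`. The `1/n` term pays for the upper end of the telescoped sum exceeding `log n`. -/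
lemma le_deriv_logFactorSeq {t σ y : ℝ} (ht : 6.29073 ≤ |t|) (hy : 1 / 2 ≤ y) (hyσ : y ≤ σ)
    {n : ℕ} (hn : n ≠ 0) :
    5e-6 - (σ + 2 + |t|) / n ≤ deriv (logFactorSeq t n) y := by
  rw [(hasDerivAt_logFactorSeq ht n y).deriv]
  have hn0 : (0 : ℝ) < n := by positivity
  have ht2 : 39.5 ≤ t ^ 2 := by rw [← sq_abs]; nlinarith
  have h1 := sum_div_le_stirlingMinorant_sub ht2 (show 0 < y by linarith) (n + 1)
  have h2 := log_two_pi_le_stirlingMinorant ht (y - 1 / 2)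
  have hn1 : (1 : ℝ) ≤ n := by exact_mod_cast Nat.one_le_iff_ne_zero.mpr hn
  rw [show y + (n + 1 : ℕ) - 1 / 2 = y + n + 1 / 2 by push_cast; ring] at h1
  have h3 := stirlingMinorant_le (t := t) (show 1 ≤ y + n + 1 / 2 by linarith)
  have h4 : 1 / (y + n + 1 / 2) ≤ 1 / n := by gcongr; linarith
  have h5 : Real.log (y + n + 1 / 2 + |t|) - Real.log n ≤ (σ + 1 + |t|) / n := by
    rw [← Real.log_div (by positivity) hn0.ne']
    refine (Real.log_le_sub_one_of_pos (by positivity)).trans ?_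
    rw [div_sub_one hn0.ne']
    gcongr
    linarith
  have hc := lt_cosh_pi_mul ht
  have h6 : Real.pi * Real.sin (Real.pi * y) /
      (2 * (Real.cosh (Real.pi * t) + Real.cos (Real.pi * y))) ≤ 5e-6 := by
    have := Real.neg_one_le_cos (Real.pi * y)
    rw [div_le_iff₀ (by linarith)]
    have hs : Real.pi * Real.sin (Real.pi * y) ≤ 3.15 := by
      nlinarith [Real.sin_le_one (Real.pi * y), Real.pi_pos, Real.pi_lt_d2]
    linarith
  have h7 : (σ + 2 + |t|) / n = (σ + 1 + |t|) / n + 1 / n := by ring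
  rw [h7]
  linarith

lemma mul_le_logFactorSeq_sub {t σ : ℝ} (ht : 6.29073 ≤ |t|) (hσ : 1 / 2 ≤ σ)
    {n : ℕ} (hn : n ≠ 0) :
    (5e-6 - (σ + 2 + |t|) / n) * (σ - 1 / 2) ≤
      logFactorSeq t n σ - logFactorSeq t n (1 / 2) := by
  have hd (y : ℝ) := hasDerivAt_logFactorSeq ht n y
  refine (convex_Icc (1 / 2 : ℝ) σ).mul_sub_le_image_sub_of_le_deriv
    (fun y _ ↦ (hd y).continuousAt.continuousWithinAt)
    (fun y _ ↦ (hd y).differentiableAt.differentiableWithinAt) (fun y hy ↦ ?_)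
    (1 / 2) (left_mem_Icc.mpr hσ) σ (right_mem_Icc.mpr hσ) hσ
  rw [interior_Icc] at hy
  exact le_deriv_logFactorSeq ht hy.1.le hy.2.le hn

lemma norm_cos_pi_mul_div_two_sq (s : ℂ) :
    ‖cos (Real.pi * s / 2)‖ ^ 2 =
      (Real.cosh (Real.pi * s.im) + Real.cos (Real.pi * s.re)) / 2 := by
  have hre : (Real.pi * s / 2 : ℂ).re = Real.pi * s.re / 2 := by simp
  have him : (Real.pi * s / 2 : ℂ).im = Real.pi * s.im / 2 := by simp
  have h1 : Real.cosh (Real.pi * s.im) = 2 * Real.sinh (Real.pi * s.im / 2) ^ 2 + 1 := by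
    rw [show Real.pi * s.im = 2 * (Real.pi * s.im / 2) by ring, Real.cosh_two_mul,
      Real.cosh_sq]
    ring_nf
  have h2 : Real.cos (Real.pi * s.re) = 2 * Real.cos (Real.pi * s.re / 2) ^ 2 - 1 := by
    rw [← Real.cos_two_mul]; ring_nf
  rw [Complex.cos_eq, hre, him, h1, h2, ← normSq_eq_norm_sq, ← ofReal_cos, ← ofReal_cosh,
    ← ofReal_sin, ← ofReal_sinh, normSq_apply]
  simp only [sub_re, sub_im, mul_re, mul_im, ofReal_re, ofReal_im, I_re, I_im]
  linear_combination Real.cos (Real.pi * s.re / 2) ^ 2 * Real.cosh_sq (Real.pi * s.im / 2)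
    + Real.sinh (Real.pi * s.im / 2) ^ 2 * Real.sin_sq_add_cos_sq (Real.pi * s.re / 2)

lemma norm_GammaSeq_factor_sq {t : ℝ} (ht : 6.29073 ≤ |t|) {n : ℕ} (hn : n ≠ 0) {s : ℂ}
    (hs : s.im = t) :
    ‖2 * (2 * Real.pi : ℂ) ^ (-s) * GammaSeq s n * cos (Real.pi * s / 2)‖ ^ 2 =
      2 * (n.factorial : ℝ) ^ 2 * Real.exp (2 * logFactorSeq t n s.re) := by
  have ht0 : t ≠ 0 := by rintro rfl; norm_num at ht
  have hn0 : (0 : ℝ) < n := by positivity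
  have hc : 0 < Real.cosh (Real.pi * t) + Real.cos (Real.pi * s.re) := by
    linarith [lt_cosh_pi_mul ht, Real.neg_one_le_cos (Real.pi * s.re)]
  have hpi : ‖(2 * Real.pi : ℂ) ^ (-s)‖ = Real.exp (-(s.re * Real.log (2 * Real.pi))) := by
    rw [show (2 * Real.pi : ℂ) = ((2 * Real.pi : ℝ) : ℂ) by push_cast; rfl,
      norm_cpow_eq_rpow_re_of_pos (by positivity), Real.rpow_def_of_pos (by positivity), neg_re]
    ring_nf
  have hnn : ‖(n : ℂ) ^ s‖ = Real.exp (s.re * Real.log n) := by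
    rw [show (n : ℂ) = ((n : ℝ) : ℂ) by push_cast; rfl,
      norm_cpow_eq_rpow_re_of_pos hn0, Real.rpow_def_of_pos hn0, mul_comm]
  have hprod : ‖∏ j ∈ Finset.range (n + 1), (s + j)‖ ^ 2 =
      Real.exp (∑ j ∈ Finset.range (n + 1), Real.log ((s.re + j) ^ 2 + t ^ 2)) := by
    rw [norm_prod, ← Finset.prod_pow, Real.exp_sum]
    refine Finset.prod_congr rfl fun j _ ↦ ?_
    rw [Real.exp_log (by positivity), ← normSq_eq_norm_sq, normSq_apply]
    simp [hs]
    ring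
  have hexp : Real.exp (2 * logFactorSeq t n s.re) =
      Real.exp (s.re * Real.log n) ^ 2 * Real.exp (-(s.re * Real.log (2 * Real.pi))) ^ 2
        / Real.exp (∑ j ∈ Finset.range (n + 1), Real.log ((s.re + j) ^ 2 + t ^ 2))
        * (Real.cosh (Real.pi * t) + Real.cos (Real.pi * s.re)) := by
    conv_rhs => rw [← Real.exp_log hc]
    rw [← Real.exp_nat_mul, ← Real.exp_nat_mul, ← Real.exp_add, ← Real.exp_sub, ← Real.exp_add,
      logFactorSeq]
    congr 1
    push_cast
    ring
  rw [hexp, GammaSeq, norm_mul, norm_mul, norm_mul, norm_div, norm_mul, mul_pow, mul_pow, mul_pow,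
    div_pow, mul_pow, hprod, hpi, hnn, norm_cos_pi_mul_div_two_sq, hs, norm_natCast, norm_ofNat]
  ring

/-- On the critical line `1 - s` is the conjugate of `s`, so the reflection formula gives `|Γ(s)|² =
π / cosh(πt)`, which cancels the cosine factor. -/
lemma norm_Gamma_factor_half {t : ℝ} :
    ‖2 * (2 * Real.pi : ℂ) ^ (-(1 / 2 + t * I)) * Gamma (1 / 2 + t * I)
      * cos (Real.pi * (1 / 2 + t * I) / 2)‖ ^ 2 = 1 := by
  set s : ℂ := 1 / 2 + t * I with hs
  have hre : s.re = 1 / 2 := by simp [hs]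
  have him : s.im = t := by simp [hs]
  have hconj : (starRingEnd ℂ) s = 1 - s := by
    apply Complex.ext <;> simp [hre]
    norm_num
  have hΓ : ((‖Gamma s‖ ^ 2 : ℝ) : ℂ) = ((Real.pi / Real.cosh (Real.pi * t) : ℝ) : ℂ) := by
    rw [← normSq_eq_norm_sq, normSq_eq_conj_mul_self, ← Gamma_conj, hconj, mul_comm,
      Gamma_mul_Gamma_one_sub, hs,
      show (Real.pi : ℂ) * (1 / 2 + t * I) = (Real.pi * t : ℂ) * I + Real.pi / 2 by ring,
      Complex.sin_add_pi_div_two, Complex.cos_mul_I]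
    push_cast
    rfl
  have hΓ' := ofReal_injective hΓ
  have hpi : ‖(2 * Real.pi : ℂ) ^ (-s)‖ ^ 2 = (2 * Real.pi)⁻¹ := by
    rw [show (2 * Real.pi : ℂ) = ((2 * Real.pi : ℝ) : ℂ) by push_cast; rfl,
      norm_cpow_eq_rpow_re_of_pos (by positivity), ← Real.rpow_natCast,
      ← Real.rpow_mul (by positivity), neg_re, hre, ← Real.rpow_neg_one]
    norm_num
  have hcos : Real.cos (Real.pi * (1 / 2)) = 0 := by
    rw [mul_one_div, Real.cos_pi_div_two]
  have := Real.cosh_pos (Real.pi * t)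
  rw [norm_mul, norm_mul, norm_mul, mul_pow, mul_pow, mul_pow, hΓ', hpi,
    norm_cos_pi_mul_div_two_sq, him, hre, hcos, norm_ofNat]
  field_simp
  norm_num

/-- The factor in the functional equation of the zeta function has modulus greater than one to the
right of the critical line, away from the real axis. -/
lemma one_lt_norm_Gamma_factor {s : ℂ} (hσ : 1 / 2 < s.re) (ht : 6.29073 ≤ |s.im|) :
    1 < ‖2 * (2 * Real.pi : ℂ) ^ (-s) * Gamma s * cos (Real.pi * s / 2)‖ := by
  have hlim (z : ℂ) : Tendsto (fun n ↦
      ‖2 * (2 * Real.pi : ℂ) ^ (-z) * GammaSeq z n * cos (Real.pi * z / 2)‖ ^ 2) atTop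
      (𝓝 (‖2 * (2 * Real.pi : ℂ) ^ (-z) * Gamma z * cos (Real.pi * z / 2)‖ ^ 2)) :=
    ((((GammaSeq_tendsto_Gamma z).const_mul _).mul_const _).norm).pow 2
  have hexp : Tendsto (fun n : ℕ ↦ Real.exp
      (2 * ((5e-6 - (s.re + 2 + |s.im|) / n) * (s.re - 1 / 2)))) atTop
      (𝓝 (Real.exp (2 * ((5e-6 - 0) * (s.re - 1 / 2))))) :=
    (Real.continuous_exp.tendsto _).comp
      (((tendsto_const_nhds.sub (tendsto_const_div_atTop_nhds_zero_nat _)).mul_const _).const_mul 2)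
  -- Comparison with `1/2 + it` cancels the common factor `2 (n!)²`; the growth rate `5e-6` is
  -- uniform in `n`, so strictness survives the limit.
  have hle := le_of_tendsto_of_tendsto ((hlim (1 / 2 + s.im * I)).mul hexp) (hlim s) <| by
    filter_upwards [eventually_ne_atTop 0] with n hn
    rw [norm_GammaSeq_factor_sq ht hn rfl, norm_GammaSeq_factor_sq ht hn (by simp),
      show (1 / 2 + s.im * I : ℂ).re = 1 / 2 by simp, mul_assoc _ (Real.exp _), ← Real.exp_add]
    gcongr
    linarith [mul_le_logFactorSeq_sub ht hσ.le hn]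
  rw [norm_Gamma_factor_half, one_mul] at hle
  have h1 : 1 < Real.exp (2 * ((5e-6 - 0) * (s.re - 1 / 2))) := by
    rw [Real.one_lt_exp_iff]
    have : 0 < s.re - 1 / 2 := by linarith
    norm_num at this ⊢
    linarith
  exact (one_lt_sq_iff₀ (norm_nonneg _)).mp (h1.trans_le hle)

/-! ### Reflection of zeros and the equivalence. -/

lemma riemannZeta_one_sub_eq_zero {s : ℂ} (hζ : riemannZeta s = 0)
    (htriv : ¬∃ n : ℕ, s = -2 * (n + 1)) (hs1 : s ≠ 1) : riemannZeta (1 - s) = 0 := by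
  have hs0 : s ≠ 0 := by
    rintro rfl
    norm_num [riemannZeta_zero] at hζ
  -- `Gammaℝ` takes the default value 0 at its poles `0, -2, -4, …`, so this excludes exactly `0`
  -- and the trivial zeros.
  have hΓ : Gammaℝ s ≠ 0 := by
    rw [Ne, Gammaℝ_eq_zero_iff]
    rintro ⟨n, hn⟩
    cases n with
    | zero => simp [hs0] at hn
    | succ n => exact htriv ⟨n, by rw [hn]; push_cast; ring⟩
  rw [riemannZeta_def_of_ne_zero hs0, div_eq_zero_iff, or_iff_left hΓ] at hζ
  rw [riemannZeta_def_of_ne_zero (sub_ne_zero.mpr hs1.symm), completedRiemannZeta_one_sub, hζ,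
    zero_div]

theorem corollary1 :
    RiemannHypothesis ↔
      ∀ s : ℂ, 1 / 2 < s.re → 6.29073 ≤ |s.im| →
        ‖riemannZeta s‖ < ‖riemannZeta (1 - s)‖ := by
  constructor
  · intro hRH s hσ ht
    have hne_real (r : ℝ) : s ≠ r := by
      rintro rfl
      norm_num at ht
    have hs1 : s ≠ 1 := by simpa using hne_real 1
    have hζ : riemannZeta s ≠ 0 := by
      intro h
      refine hσ.ne' (hRH s h ?_ hs1)
      rintro ⟨n, hn⟩
      exact hne_real (-2 * (n + 1)) (by rw [hn]; push_cast; rfl)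
    rw [riemannZeta_one_sub (fun n h ↦ hne_real (-n) (by rw [h]; push_cast; rfl)) hs1, norm_mul]
    exact lt_mul_of_one_lt_left (norm_pos_iff.mpr hζ) (one_lt_norm_Gamma_factor hσ ht)
  · intro h
    have key (s : ℂ) (hζ : riemannZeta s = 0) (hs1 : s ≠ 1) (hσ : 1 / 2 < s.re) : False := by
      have hre : s.re < 1 := by
        by_contra! hge
        exact riemannZeta_ne_zero_of_one_le_re hge hζ
      rcases lt_or_ge |s.im| 6.29073 with ht | ht
      · exact riemannZeta_ne_zero_of_abs_im_lt (by linarith) hre.le ht hζ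
      · have htriv : ¬∃ n : ℕ, s = -2 * (n + 1) := by
          rintro ⟨n, rfl⟩
          norm_num at ht
        have := h s hσ ht
        rw [hζ, riemannZeta_one_sub_eq_zero hζ htriv hs1] at this
        exact lt_irrefl _ this
    intro s hζ htriv hs1
    rcases lt_trichotomy s.re (1 / 2) with hlt | heq | hgt
    · refine (key (1 - s) (riemannZeta_one_sub_eq_zero hζ htriv hs1) ?_ ?_).elim
      · rw [Ne, sub_eq_self]
        rintro rfl
        norm_num [riemannZeta_zero] at hζ
      · rw [sub_re, one_re]; linarith
    · exact heq
    · exact (key s hζ hs1 hgt).elim
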